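/- Let $\mathbf{AS}$ be the set of absolutely separable two-qubit states, i.e. of the density matrices $\rho$ on $\mathbb{C}^2\otimes\mathbb{C}^2$ such that $U\rho U^\dagger$ is separable (a convex combination of product states) for every unitary $U$ on $\mathbb{C}^2\otimes\mathbb{C}^2$. Let $\rho\in\mathbf{AS}$ have rank $4$, let $\rho\neq \mathbb{I}/4$, and let its eigenvalues $\lambda_1\ge\lambda_2\ge\lambda_3\ge\lambda_4$ satisfy $\lambda_1-\lambda_3<2\sqrt{\lambda_2\lambda_4}$. Then $\rho$ is a convex combination of the maximally mixed state $\mathbb{I}/4$ and a boundary point of $\mathbf{AS}$ (the boundary being taken in the affine hull of $\mathbf{AS}$, the space of Hermitian matrices of trace one). More precisely, there is $\epsilon$ with $0<\epsilon\le\lambda_4$, $4\epsilon<1$ and $\lambda_1-\lambda_3=2\sqrt{(\lambda_2-\epsilon)(\lambda_4-\epsilon)}$ such that $\sigma=(\rho-\epsilon\,\mathbb{I})/(1-4\epsilon)$ belongs to $\mathbf{AS}$ and is a boundary point of $\mathbf{AS}$, and $\rho=(1-4\epsilon)\,\sigma+4\epsilon\,\mathbb{I}/4$. -/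

import Mathlib

open scoped Kronecker ComplexOrder

noncomputable section

/-- A state (density matrix): a positive semidefinite complex matrix of trace one. -/
def IsState {n : Type*} [Fintype n] (ρ : Matrix n n ℂ) : Prop :=
  ρ.PosSemidef ∧ ρ.trace = 1

theorem IsState.isHermitian {n : Type*} [Fintype n] {ρ : Matrix n n ℂ} (h : IsState ρ) :
    ρ.IsHermitian :=
  h.1.isHermitian

/-- The product states of a bipartite system. -/
def productStates (m n : Type*) [Fintype m] [Fintype n] : Set (Matrix (m × n) (m × n) ℂ) :=
  {ρ | ∃ (a : Matrix m m ℂ) (b : Matrix n n ℂ), IsState a ∧ IsState b ∧ ρ = a ⊗ₖ b}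

/-- The separable states: finite convex combinations of product states.
A state that is not separable is entangled. -/
def separableStates (m n : Type*) [Fintype m] [Fintype n] : Set (Matrix (m × n) (m × n) ℂ) :=
  convexHull ℝ (productStates m n)

/-- The set **AS** of absolutely separable states: the states `ρ` that no global unitary
transformation `ρ ↦ U ρ U†` maps to an entangled state. -/
def absSepStates (m n : Type*) [Fintype m] [Fintype n] [DecidableEq m] [DecidableEq n] :
    Set (Matrix (m × n) (m × n) ℂ) :=
  {ρ | IsState ρ ∧ ∀ U ∈ Matrix.unitaryGroup (m × n) ℂ,
    U * ρ * star U ∈ separableStates m n}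

/-- The boundary of **AS**. As all states are Hermitian of trace one, **AS** has empty interior in
the space of all matrices; the boundary of this convex set is taken in its affine hull (which is
the affine space of Hermitian matrices of trace one). -/
def absSepBoundary (m n : Type*) [Fintype m] [Fintype n] [DecidableEq m] [DecidableEq n] :
    Set (Matrix (m × n) (m × n) ℂ) :=
  intrinsicFrontier ℝ (absSepStates m n)

/-- The maximally mixed state `I / 4` of two qubits. -/
def maxMixed : Matrix (Fin 2 × Fin 2) (Fin 2 × Fin 2) ℂ :=
  (1 / 4 : ℝ) • (1 : Matrix (Fin 2 × Fin 2) (Fin 2 × Fin 2) ℂ)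

/-- The four eigenvalues of a Hermitian two-qubit matrix, counted with multiplicity, in decreasing
order: index `0` is the largest eigenvalue `λ₁`, index `3` the smallest eigenvalue `λ₄`. -/
def sortedEigenvalues {ρ : Matrix (Fin 2 × Fin 2) (Fin 2 × Fin 2) ℂ} (h : ρ.IsHermitian)
    (i : Fin 4) : ℝ :=
  h.eigenvalues₀ (Fin.cast (by simp) i)

theorem sortedEigenvalues_antitone {ρ : Matrix (Fin 2 × Fin 2) (Fin 2 × Fin 2) ℂ}
    (h : ρ.IsHermitian) : Antitone (sortedEigenvalues h) := by
  intro i j hij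
  exact h.eigenvalues₀_antitone (by simpa using hij)

end

noncomputable section

open Matrix

/-! Everything rests on the spectral criterion: a two-qubit state is absolutely separable iff `λ₁ -
λ₃ ≤ 2√(λ₂λ₄)`. Subtracting `ε I` leaves the left side fixed and shrinks the right side to zero at
`ε = λ₄`, so some `ε` gives equality; after rescaling, that state saturates the criterion.

Sufficiency. Write the state as `W Wᴴ`, where `W` may be changed to `W V` with `V` unitary. The
columns are product vectors iff the symmetric matrix `Wᵀ S W` has zero diagonal, `S` being the spin
flip. Takagi factorization (`exists_takagi`) makes it `diag(s)`; phases followed by a Hadamard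
matrix then make every diagonal entry `¼ ∑ sᵢuᵢ`, which can be made zero iff the `sᵢ` are sides of a
closed quadrilateral. That inequality is `two_mul_le_sum_of_congr_diagonal`: `∑ sᵢ - 2sₖ` is the
trace of `diag(μ)` times a Hermitian matrix with spectrum `r, 1, 1/r, -1`, and von Neumann's lower
trace inequality with AM-GM bounds it below by `μ₂ - μ₀ + 2√(μ₁μ₃)`.

Necessity (`sq_le_of_mem_absSepStates`) needs only one unitary, with a partly Bell eigenbasis, and
the partial transpose. It shows that prolonging the segment from `I/4` beyond a saturating state
leaves `AS`, so that state is a boundary point. -/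

/-! ### Takagi factorization by maximization over the unitary group -/

theorem Matrix.isCompact_unitaryGroup {n : Type*} [Fintype n] [DecidableEq n] :
    IsCompact (unitaryGroup n ℂ : Set (Matrix n n ℂ)) := by
  have hK : IsCompact (Set.univ.pi fun _ : n => Set.univ.pi fun _ : n =>
      Metric.closedBall (0 : ℂ) 1) :=
    isCompact_univ_pi fun _ => isCompact_univ_pi fun _ => isCompact_closedBall _ _
  refine hK.of_isClosed_subset ?_ ?_
  · have : (unitaryGroup n ℂ : Set (Matrix n n ℂ)) = {U | star U * U = 1} := by
      ext U
      exact mem_unitaryGroup_iff'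
    rw [this]
    refine isClosed_eq ?_ continuous_const
    simp only [star_eq_conjTranspose]
    fun_prop
  · intro U hU i _ j _
    simpa using entry_norm_bound_of_unitary hU i j

attribute [local instance] Matrix.linftyOpNormedRing Matrix.linftyOpNormedAlgebra in
-- First variation of the Takagi objective along a one-parameter group; the operator norm serves
-- only to differentiate the exponential.
theorem Matrix.hasDerivAt_trace_mul_exp {n : Type*} [Fintype n] [DecidableEq n]
    (D N K : Matrix n n ℂ) :
    HasDerivAt (fun t : ℝ => trace (D * (NormedSpace.exp (t • K))ᵀ * N * NormedSpace.exp (t • K)))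
      (trace (D * Kᵀ * N) + trace (D * N * K)) 0 := by
  have h1 := hasDerivAt_exp_smul_const (𝕂 := ℝ) K (0 : ℝ)
  have h2 := hasDerivAt_exp_smul_const (𝕂 := ℝ) Kᵀ (0 : ℝ)
  have h3 := ((h2.const_mul D).mul_const N).mul h1
  have h4 := (traceLinearMap n ℝ ℂ).toContinuousLinearMap.hasFDerivAt.comp_hasDerivAt (0 : ℝ) h3
  have h5 : (fun t : ℝ => trace (D * (NormedSpace.exp (t • K))ᵀ * N * NormedSpace.exp (t • K)))
      = fun t : ℝ => trace (D * NormedSpace.exp (t • Kᵀ) * N * NormedSpace.exp (t • K)) := by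
    funext t
    rw [← exp_transpose, transpose_smul]
  rw [h5, ← trace_add]
  refine HasDerivAt.congr_deriv h4 ?_
  change trace _ = trace _
  simp only [zero_smul, NormedSpace.exp_zero, one_mul, mul_one]

theorem Matrix.exp_smul_mem_unitaryGroup {n : Type*} [Fintype n] [DecidableEq n]
    {K : Matrix n n ℂ} (hK : Kᴴ = -K) (t : ℝ) :
    NormedSpace.exp (t • K) ∈ unitaryGroup n ℂ := by
  rw [mem_unitaryGroup_iff', star_eq_conjTranspose, ← exp_conjTranspose, conjTranspose_smul, hK,
    star_trivial, smul_neg, exp_neg]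
  exact nonsing_inv_mul _ ((isUnit_iff_isUnit_det _).1 (isUnit_exp _))

/-- A matrix `X` with `Re tr (X K) = 0` for all skew-Hermitian `K` is Hermitian. -/
theorem Matrix.isHermitian_of_re_trace_mul_eq_zero {n : Type*} [Fintype n] [DecidableEq n]
    {X : Matrix n n ℂ} (h : ∀ K : Matrix n n ℂ, Kᴴ = -K → (trace (X * K)).re = 0) :
    X.IsHermitian := by
  -- Test against the skew part `K = X - Xᴴ`, for which `Re tr (X K) = -½ tr (Kᴴ K)`.
  have h1 := h (X - Xᴴ) (by simp)
  have h2 : trace ((X - Xᴴ)ᴴ * (X - Xᴴ)) = 0 := by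
    have e1 : trace ((X - Xᴴ)ᴴ * (X - Xᴴ))
        = -(trace (X * (X - Xᴴ)) + star (trace (X * (X - Xᴴ)))) := by
      rw [← trace_conjTranspose, conjTranspose_mul]
      simp only [conjTranspose_sub, conjTranspose_conjTranspose, mul_sub, sub_mul, trace_sub]
      rw [trace_mul_comm Xᴴ X]
      ring
    rw [e1]
    apply Complex.ext <;> simp [h1]
  have h3 := trace_conjTranspose_mul_self_eq_zero_iff.1 h2
  exact (sub_eq_zero.1 h3).symm

theorem Complex.exists_norm_eq_one_mul_mul_eq_norm (z : ℂ) :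
    ∃ u : ℂ, ‖u‖ = 1 ∧ u * z * u = ‖z‖ := by
  refine ⟨Complex.exp ((-z.arg / 2 : ℝ) * Complex.I), Complex.norm_exp_ofReal_mul_I _, ?_⟩
  have h : Complex.exp ((-z.arg / 2 : ℝ) * Complex.I) * Complex.exp (z.arg * Complex.I) *
      Complex.exp ((-z.arg / 2 : ℝ) * Complex.I) = 1 := by
    rw [← Complex.exp_add, ← Complex.exp_add, ← Complex.exp_zero]
    congr 1
    push_cast
    ring
  nth_rw 2 [← Complex.norm_mul_exp_arg_mul_I z]
  linear_combination (‖z‖ : ℂ) * h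

/-- **Takagi factorization**: a complex symmetric matrix is diagonalized by a unitary congruence,
with nonnegative diagonal entries. -/
theorem Matrix.exists_takagi {n : ℕ} {M : Matrix (Fin n) (Fin n) ℂ} (hM : Mᵀ = M) :
    ∃ V ∈ unitaryGroup (Fin n) ℂ, ∃ s : Fin n → ℝ, (∀ i, 0 ≤ s i) ∧
      Vᵀ * M * V = diagonal fun i => (s i : ℂ) := by
  -- Distinct positive weights: at a maximizer `D N` is Hermitian, so `dᵢ |Nᵢⱼ| = dⱼ |Nᵢⱼ|` and the
  -- off-diagonal entries vanish.
  set d : Fin n → ℝ := fun i => (i : ℝ) + 1 with hd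
  set D : Matrix (Fin n) (Fin n) ℂ := diagonal fun i => (d i : ℂ) with hD
  obtain ⟨V, hV, hmax⟩ := isCompact_unitaryGroup.exists_isMaxOn
    (⟨1, one_mem _⟩ : (unitaryGroup (Fin n) ℂ : Set (Matrix (Fin n) (Fin n) ℂ)).Nonempty)
    (f := fun U => (trace (D * Uᵀ * M * U)).re) (by fun_prop)
  set N := Vᵀ * M * V with hN
  have hNs : Nᵀ = N := by simp [hN, hM, mul_assoc]
  have hherm : (D * N).IsHermitian := by
    refine isHermitian_of_re_trace_mul_eq_zero fun K hK => ?_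
    have h1 := hasDerivAt_trace_mul_exp D N K
    have h2 : HasDerivAt (fun t : ℝ => (trace (D * (NormedSpace.exp (t • K))ᵀ * N *
        NormedSpace.exp (t • K))).re) (trace (D * Kᵀ * N) + trace (D * N * K)).re 0 :=
      Complex.reCLM.hasFDerivAt.comp_hasDerivAt (0 : ℝ) h1
    have h3 : IsLocalMax (fun t : ℝ => (trace (D * (NormedSpace.exp (t • K))ᵀ * N *
        NormedSpace.exp (t • K))).re) 0 := by
      refine Filter.Eventually.of_forall fun t => ?_
      have := hmax (mul_mem hV (exp_smul_mem_unitaryGroup hK t))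
      simpa [hN, mul_assoc, NormedSpace.exp_zero] using this
    have h4 := h3.hasDerivAt_eq_zero h2
    have h5 : trace (D * Kᵀ * N) = trace (D * N * K) := by
      rw [← trace_transpose]
      simp only [transpose_mul, hNs, transpose_transpose]
      rw [hD, diagonal_transpose, ← hD, ← mul_assoc, trace_mul_cycle]
    rw [h5, Complex.add_re] at h4
    linarith
  have hoff : ∀ i j, i ≠ j → N i j = 0 := by
    intro i j hij
    have h1 := congrFun (congrFun hherm i) j
    have h2 : N j i = N i j := congrFun (congrFun hNs i) j
    simp only [hD, conjTranspose_apply, diagonal_mul, h2, star_mul', RCLike.star_def,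
      Complex.conj_ofReal] at h1
    have h3 := congrArg norm h1
    simp only [norm_mul, Complex.norm_real, RCLike.norm_conj] at h3
    by_contra hne
    have h4 := mul_right_cancel₀ (norm_ne_zero_iff.2 hne) h3
    simp only [hd, Real.norm_eq_abs] at h4
    rw [abs_of_pos (by positivity), abs_of_pos (by positivity)] at h4
    have : (j : ℕ) = i := by exact_mod_cast add_right_cancel h4
    exact hij (Fin.ext this.symm)
  -- `N` is diagonal by now; a diagonal unitary absorbs the phases of its entries.
  choose u hu using fun i => Complex.exists_norm_eq_one_mul_mul_eq_norm (N i i)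
  refine ⟨V * diagonal u, mul_mem hV ?_, fun i => ‖N i i‖, fun i => norm_nonneg _, ?_⟩
  · rw [mem_unitaryGroup_iff', star_eq_conjTranspose, diagonal_conjTranspose, diagonal_mul_diagonal,
      ← diagonal_one]
    congr 1
    funext i
    simpa [(hu i).1] using Complex.conj_mul' (u i)
  · rw [transpose_mul, diagonal_transpose]
    have : diagonal u * Vᵀ * M * (V * diagonal u) = diagonal u * N * diagonal u := by
      simp [hN, mul_assoc]
    rw [this]
    ext i j
    rw [mul_diagonal, diagonal_mul]
    by_cases hij : i = j
    · subst hij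
      simp [(hu i).2]
    · simp [hoff i j hij, diagonal_apply_ne _ hij]

/-! ### Ordered spectral decomposition and the lower trace inequality -/

/-- The spectral decomposition with eigenvalues in decreasing order. -/
theorem Matrix.IsHermitian.exists_eq_mul_diagonal_eigenvalues₀ {n : Type*} [Fintype n]
    [DecidableEq n] {A : Matrix n n ℂ} (hA : A.IsHermitian) {k : ℕ} (hk : k = Fintype.card n) :
    ∃ P : Matrix n (Fin k) ℂ, Pᴴ * P = 1 ∧ P * Pᴴ = 1 ∧
      A = P * diagonal (fun i => (hA.eigenvalues₀ (Fin.cast hk i) : ℂ)) * Pᴴ := by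
  subst hk
  set e : Fin (Fintype.card n) ≃ n := Fintype.equivOfCardEq (Fintype.card_fin _) with he
  set Q : Matrix n n ℂ := hA.eigenvectorUnitary.1 with hQ
  have h1 : Qᴴ * Q = 1 := mem_unitaryGroup_iff'.1 hA.eigenvectorUnitary.2
  have h2 : Q * Qᴴ = 1 := mem_unitaryGroup_iff.1 hA.eigenvectorUnitary.2
  refine ⟨Q.submatrix id e, ?_, ?_, ?_⟩
  · rw [conjTranspose_submatrix]
    exact (submatrix_mul_equiv _ _ _ (Equiv.refl n) _).trans (by rw [h1, submatrix_one_equiv])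
  · rw [conjTranspose_submatrix, submatrix_mul_equiv, h2]
    simp
  · have h3 : diagonal (fun i => (hA.eigenvalues₀ (Fin.cast rfl i) : ℂ)) =
        (diagonal (fun i => (hA.eigenvalues i : ℂ))).submatrix e e := by
      rw [submatrix_diagonal_equiv]
      congr 1
      funext i
      simp [eigenvalues, ← he]
    rw [h3, conjTranspose_submatrix, submatrix_mul_equiv, submatrix_mul_equiv]
    have := hA.spectral_theorem
    rw [Unitary.conjStarAlgAut_apply] at this
    rw [submatrix_id_id]
    exact this

/-- By Birkhoff's theorem `S` is a convex combination of permutation matrices, and the right side is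
linear in `S`; for a permutation this is the rearrangement inequality. -/
theorem sum_mul_rev_le_sum_mul_of_mem_doublyStochastic {n : ℕ} {μ ξ : Fin n → ℝ}
    (hμ : Antitone μ) (hξ : Antitone ξ) {S : Matrix (Fin n) (Fin n) ℝ}
    (hS : S ∈ doublyStochastic ℝ (Fin n)) :
    ∑ i, μ i * ξ i.rev ≤ ∑ i, ∑ j, μ i * ξ j * S i j := by
  obtain ⟨w, hw0, hw1, rfl⟩ := exists_eq_sum_perm_of_mem_doublyStochastic hS
  have h1 : ∀ σ : Equiv.Perm (Fin n),
      ∑ i, ∑ j, μ i * ξ j * (σ.permMatrix ℝ) i j = ∑ i, μ i * ξ (σ i) := by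
    intro σ
    refine Finset.sum_congr rfl fun i _ => ?_
    simp [Equiv.Perm.permMatrix, PEquiv.toMatrix_apply, eq_comm]
  have h2 : ∑ i, ∑ j, μ i * ξ j * (∑ σ, w σ • σ.permMatrix ℝ) i j
      = ∑ σ, w σ * ∑ i, μ i * ξ (σ i) := by
    calc ∑ i, ∑ j, μ i * ξ j * (∑ σ, w σ • σ.permMatrix ℝ) i j
        = ∑ i, ∑ j, ∑ σ, w σ * (μ i * ξ j * (σ.permMatrix ℝ) i j) := by
          refine Finset.sum_congr rfl fun i _ => Finset.sum_congr rfl fun j _ => ?_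
          rw [Matrix.sum_apply, Finset.mul_sum]
          refine Finset.sum_congr rfl fun σ _ => ?_
          rw [Matrix.smul_apply, smul_eq_mul]
          ring
      _ = ∑ i, ∑ σ, ∑ j, w σ * (μ i * ξ j * (σ.permMatrix ℝ) i j) :=
          Finset.sum_congr rfl fun i _ => Finset.sum_comm
      _ = ∑ σ, ∑ i, ∑ j, w σ * (μ i * ξ j * (σ.permMatrix ℝ) i j) := Finset.sum_comm
      _ = ∑ σ, w σ * ∑ i, μ i * ξ (σ i) := by simp_rw [← Finset.mul_sum, h1]
  rw [h2]
  have h3 : ∀ σ : Equiv.Perm (Fin n), ∑ i, μ i * ξ i.rev ≤ ∑ i, μ i * ξ (σ i) := by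
    intro σ
    have hv : Antivary μ (fun i => ξ i.rev) :=
      hμ.antivary (fun i j hij => hξ (Fin.rev_le_rev.2 hij))
    have := hv.sum_mul_le_sum_mul_comp_perm (σ := σ.trans Fin.revPerm)
    simpa using this
  calc ∑ i, μ i * ξ i.rev = ∑ σ, w σ * ∑ i, μ i * ξ i.rev := by rw [← Finset.sum_mul, hw1, one_mul]
    _ ≤ _ := Finset.sum_le_sum fun σ _ => mul_le_mul_of_nonneg_left (h3 σ) (hw0 σ)

theorem Matrix.normSq_mem_doublyStochastic {n : Type*} [Fintype n] [DecidableEq n]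
    {P : Matrix n n ℂ} (hP : P ∈ unitaryGroup n ℂ) :
    (of fun i j => ‖P i j‖ ^ 2) ∈ doublyStochastic ℝ n := by
  rw [mem_doublyStochastic_iff_sum]
  refine ⟨fun i j => by simp, fun i => ?_, fun j => ?_⟩
  · have := congrFun (congrFun (mem_unitaryGroup_iff.1 hP) i) i
    simp only [mul_apply, star_apply, RCLike.star_def, Complex.mul_conj', one_apply_eq] at this
    exact_mod_cast this
  · have := congrFun (congrFun (mem_unitaryGroup_iff'.1 hP) j) j
    simp only [mul_apply, star_apply, RCLike.star_def, Complex.conj_mul', one_apply_eq] at this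
    exact_mod_cast this

/-- The lower trace inequality of von Neumann, for decreasingly ordered eigenvalues. -/
theorem Matrix.sum_mul_rev_le_re_trace {n : ℕ} {μ ξ : Fin n → ℝ}
    (hμ : Antitone μ) (hξ : Antitone ξ) {P : Matrix (Fin n) (Fin n) ℂ}
    (hP : P ∈ unitaryGroup (Fin n) ℂ) :
    ∑ i, μ i * ξ i.rev ≤
      (trace (diagonal (fun i => (μ i : ℂ)) * (P * diagonal (fun i => (ξ i : ℂ)) * Pᴴ))).re := by
  refine (sum_mul_rev_le_sum_mul_of_mem_doublyStochastic hμ hξ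
    (normSq_mem_doublyStochastic hP)).trans_eq ?_
  rw [trace, Complex.re_sum]
  refine Finset.sum_congr rfl fun i _ => ?_
  rw [diag_apply, diagonal_mul, mul_apply, Finset.mul_sum, Complex.re_sum]
  refine Finset.sum_congr rfl fun j _ => ?_
  rw [mul_diagonal, conjTranspose_apply]
  have : (μ i : ℂ) * (P i j * ξ j * star (P i j)) = ((μ i * ξ j * ‖P i j‖ ^ 2 : ℝ) : ℂ) := by
    push_cast
    rw [← Complex.mul_conj', RCLike.star_def]
    ring
  rw [this, Complex.ofReal_re, of_apply]

/-! ### The quadrilateral inequality for the Takagi values -/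

theorem Matrix.conjTranspose_transpose_comm {m n α : Type*} [Star α] (A : Matrix m n α) :
    Aᵀᴴ = Aᴴᵀ := rfl

/-- In elementary symmetric functions the hypotheses say `e₄ = -1`, `e₃ = -e₁`, `e₂ = 0`, so the
polynomial with roots `a, b, c, d` is `(x² - 1)(x² - e₁x + 1)`. Positivity leaves only `d` for the
root `-1`; then `abc = 1` and the ordering put the root `1` at `b`. -/
theorem eq_one_of_sum_inv_eq_sum {a b c d : ℝ} (hab : b ≤ a) (hbc : c ≤ b) (hc : 0 < c)
    (hprod : a * b * c * d = -1) (h1 : a⁻¹ + b⁻¹ + c⁻¹ + d⁻¹ = a + b + c + d)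
    (h2 : a⁻¹ ^ 2 + b⁻¹ ^ 2 + c⁻¹ ^ 2 + d⁻¹ ^ 2 = a ^ 2 + b ^ 2 + c ^ 2 + d ^ 2) :
    b = 1 ∧ d = -1 ∧ a * c = 1 := by
  have hb : 0 < b := hc.trans_le hbc
  have ha : 0 < a := hb.trans_le hab
  have hd0 : d ≠ 0 := by
    rintro rfl
    simp at hprod
  have ea : a⁻¹ = -(b * c * d) := inv_eq_of_mul_eq_one_right (by linarith)
  have eb : b⁻¹ = -(a * c * d) := inv_eq_of_mul_eq_one_right (by linarith)
  have ec : c⁻¹ = -(a * b * d) := inv_eq_of_mul_eq_one_right (by linarith)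
  have ed : d⁻¹ = -(a * b * c) := inv_eq_of_mul_eq_one_right (by linarith)
  rw [ea, eb, ec, ed] at h1 h2
  have he2 : a * b + a * c + a * d + b * c + b * d + c * d = 0 := by
    have h3 : (-(b * c * d) + -(a * c * d) + -(a * b * d) + -(a * b * c)) ^ 2
        = (a + b + c + d) ^ 2 := by rw [h1]
    linear_combination (h2 - h3) / 4 + (a * b + a * c + a * d + b * c + b * d + c * d) / 2 * hprod
  have hm : (1 + a) * (1 + b) * (1 + c) * (1 + d) = 0 := by
    linear_combination he2 + hprod - h1
  have hp : (1 - a) * (1 - b) * (1 - c) * (1 - d) = 0 := by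
    linear_combination he2 + hprod + h1
  have hd : d = -1 := by
    rcases mul_eq_zero.1 hm with h | h
    · exact absurd h (by positivity)
    · linarith
  subst hd
  have habc : a * b * c = 1 := by linarith
  have hb1 : b = 1 := by
    rcases mul_eq_zero.1 hp with h | h
    · rcases mul_eq_zero.1 h with h | h
      · rcases mul_eq_zero.1 h with h | h
        · have ha1 : a = 1 := by linarith
          subst ha1
          nlinarith
        · linarith
      · have hc1 : c = 1 := by linarith
        subst hc1
        nlinarith
    · norm_num at h
  subst hb1
  exact ⟨rfl, rfl, by linarith⟩

/-- A matrix congruent to a sign matrix with a single minus sign has no two negative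
eigenvalues. -/
theorem Matrix.nonneg_or_nonneg_of_diagonal_eq {n : Type*} [Fintype n] [DecidableEq n]
    {G : Matrix n n ℂ} {ξ : n → ℝ} {k : n}
    (h : diagonal (fun i => (ξ i : ℂ)) =
      Gᴴ * diagonal (fun i => if i = k then (-1 : ℂ) else 1) * G)
    {i j : n} (hij : i ≠ j) : 0 ≤ ξ i ∨ 0 ≤ ξ j := by
  by_contra! hneg
  -- The span of `eᵢ, eⱼ` has dimension two, so it contains a nonzero `w` with `(G w)ₖ = 0`. On it
  -- the form is negative by `ξ` and nonnegative by the sign matrix.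
  obtain ⟨w, hw, hwi, hwk⟩ : ∃ w : n → ℂ, (∀ l, l ≠ i → l ≠ j → w l = 0) ∧
      (w i ≠ 0 ∨ w j ≠ 0) ∧ (G *ᵥ w) k = 0 := by
    have key : ∀ α β : ℂ, (α ≠ 0 ∨ β ≠ 0) → G k i * α + G k j * β = 0 →
        ∃ w : n → ℂ, (∀ l, l ≠ i → l ≠ j → w l = 0) ∧
          (w i ≠ 0 ∨ w j ≠ 0) ∧ (G *ᵥ w) k = 0 := by
      intro α β h1 h2
      refine ⟨Pi.single i α + Pi.single j β, fun l h3 h4 => by simp [h3, h4], ?_, ?_⟩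
      · simpa [hij, hij.symm] using h1
      · simpa [mulVec_add, mul_comm] using h2
    by_cases h0 : G k i = 0
    · exact key 1 0 (by simp) (by simp [h0])
    · exact key (G k j) (-G k i) (by simp [h0]) (by ring)
  have h1 : star w ⬝ᵥ (diagonal (fun i => (ξ i : ℂ)) *ᵥ w) =
      star (G *ᵥ w) ⬝ᵥ (diagonal (fun i => if i = k then (-1 : ℂ) else 1) *ᵥ (G *ᵥ w)) := by
    rw [h, star_mulVec, ← dotProduct_mulVec, mulVec_mulVec, mulVec_mulVec, mul_assoc]
  have h2 : (star w ⬝ᵥ (diagonal (fun i => (ξ i : ℂ)) *ᵥ w)).re = ∑ l, ξ l * ‖w l‖ ^ 2 := by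
    rw [dotProduct, Complex.re_sum]
    refine Finset.sum_congr rfl fun l _ => ?_
    rw [mulVec_diagonal, Pi.star_apply, RCLike.star_def, mul_left_comm, Complex.conj_mul',
      ← Complex.ofReal_pow, ← Complex.ofReal_mul, Complex.ofReal_re]
  have h3 : 0 ≤ (star (G *ᵥ w) ⬝ᵥ (diagonal (fun i => if i = k then (-1 : ℂ) else 1) *ᵥ
      (G *ᵥ w))).re := by
    rw [dotProduct, Complex.re_sum]
    refine Finset.sum_nonneg fun l _ => ?_
    rw [mulVec_diagonal]
    by_cases hl : l = k
    · rw [hl, hwk]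
      simp
    · rw [if_neg hl, one_mul, Pi.star_apply, RCLike.star_def, Complex.conj_mul',
        ← Complex.ofReal_pow, Complex.ofReal_re]
      positivity
  rw [← h1, h2, ← Finset.add_sum_erase _ _ (Finset.mem_univ i),
    ← Finset.add_sum_erase _ _ (Finset.mem_erase.2 ⟨hij.symm, Finset.mem_univ j⟩),
    Finset.sum_eq_zero] at h3
  · rcases hwi with h4 | h4
    · have : 0 < ‖w i‖ ^ 2 := by positivity
      nlinarith [sq_nonneg ‖w j‖]
    · have : 0 < ‖w j‖ ^ 2 := by positivity
      nlinarith [sq_nonneg ‖w i‖]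
  · intro l hl
    simp only [Finset.mem_erase] at hl
    simp [hw l hl.2.1 hl.1]

theorem Matrix.trace_conj_diagonal {n k : Type*} [Fintype n] [Fintype k] [DecidableEq k]
    {P : Matrix n k ℂ} (hP : Pᴴ * P = 1) (ξ : k → ℝ) :
    trace (P * diagonal (fun i => (ξ i : ℂ)) * Pᴴ) = ((∑ i, ξ i : ℝ) : ℂ) := by
  rw [trace_mul_cycle, hP, one_mul, trace_diagonal]
  push_cast
  rfl

/-- The spectrum of the operator `Y D Yᴴ`, where `D` is a sign matrix with one minus sign and
`Y` is orthogonal for the bilinear form given by a unitary `U`: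
it is `r ≥ 1 ≥ 1 / r > -1`. -/
theorem Matrix.eigenvalues_of_orthogonal_conj {U Y : Matrix (Fin 4) (Fin 4) ℂ}
    (hU : U ∈ unitaryGroup (Fin 4) ℂ) (hY : Yᵀ * U * Y = 1) (k : Fin 4)
    {P : Matrix (Fin 4) (Fin 4) ℂ} (hP : P ∈ unitaryGroup (Fin 4) ℂ) {ξ : Fin 4 → ℝ}
    (hξ : Antitone ξ)
    (hX : Y * diagonal (fun i => if i = k then (-1 : ℂ) else 1) * Yᴴ =
      P * diagonal (fun i => (ξ i : ℂ)) * Pᴴ) :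
    ξ 1 = 1 ∧ ξ 3 = -1 ∧ ξ 0 * ξ 2 = 1 ∧ 0 < ξ 2 := by
  have hP1 : Pᴴ * P = 1 := mem_unitaryGroup_iff'.1 hP
  have hP2 : P * Pᴴ = 1 := mem_unitaryGroup_iff.1 hP
  have hU1 : Uᴴ * U = 1 := mem_unitaryGroup_iff'.1 hU
  have hU2 : U * Uᴴ = 1 := mem_unitaryGroup_iff.1 hU
  set D : Matrix (Fin 4) (Fin 4) ℂ := diagonal (fun i => if i = k then (-1 : ℂ) else 1) with hD
  set E : Matrix (Fin 4) (Fin 4) ℂ := diagonal (fun i => (ξ i : ℂ)) with hE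
  set X := Y * D * Yᴴ with hXdef
  have hDD : D * D = 1 := by
    rw [hD, diagonal_mul_diagonal, ← diagonal_one]
    congr 1
    funext i
    split_ifs <;> norm_num
  have hDt : Dᵀ = D := diagonal_transpose _
  -- `Z` turns out to be `X⁻¹`, yet it is unitarily conjugate to `Xᵀ`: the spectrum of `X` is closed
  -- under inversion, which equates the power sums of `ξ` and `ξ⁻¹`.
  set Z := Uᴴ * Xᵀ * U with hZ
  have hXZ : X * Z = 1 := by
    have e1 : Yᴴ * (Uᴴ * Yᴴᵀ) = 1 := by
      have := congrArg conjTranspose hY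
      simpa [conjTranspose_mul, mul_assoc, conjTranspose_transpose_comm] using this
    have e2 : Y * (Yᵀ * U) = 1 := mul_eq_one_comm.1 hY
    calc X * Z = Y * D * (Yᴴ * (Uᴴ * Yᴴᵀ)) * D * Yᵀ * U := by
          simp only [hXdef, hZ, transpose_mul, hDt, mul_assoc]
      _ = Y * (D * D) * (Yᵀ * U) := by rw [e1]; simp only [mul_assoc, one_mul]
      _ = 1 := by rw [hDD, mul_one, e2]
  have hdetD : D.det = -1 := by
    rw [hD, det_diagonal, Finset.prod_ite_eq']
    simp
  have hdetX : X.det = ((∏ i, ξ i : ℝ) : ℂ) := by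
    rw [hX, det_mul, det_mul, mul_right_comm, ← det_mul, hP2, det_one, one_mul, hE, det_diagonal]
    push_cast
    rfl
  have hdetZ : Z.det = X.det := by
    rw [hZ, det_mul, det_mul, mul_right_comm, ← det_mul, hU1, det_transpose, det_one, one_mul]
  -- The determinant of `X` equals `-|det Y|²` and squares to one.
  have hprod : ∏ i, ξ i = -1 := by
    have e1 : ((∏ i, ξ i : ℝ) : ℂ) = ((-‖Y.det‖ ^ 2 : ℝ) : ℂ) := by
      rw [← hdetX, hXdef, det_mul, det_mul, hdetD, det_conjTranspose, RCLike.star_def]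
      push_cast
      rw [← Complex.mul_conj']
      ring
    have e2 : ((∏ i, ξ i : ℝ) : ℂ) * ((∏ i, ξ i : ℝ) : ℂ) = 1 := by
      have := congrArg det hXZ
      rw [det_mul X Z, hdetZ, det_one, hdetX] at this
      exact this
    have e3 : ∏ i, ξ i = -‖Y.det‖ ^ 2 := by exact_mod_cast e1
    have e4 : (∏ i, ξ i) * (∏ i, ξ i) = 1 := by exact_mod_cast e2
    rcases mul_self_eq_one_iff.1 e4 with h | h
    · have := sq_nonneg ‖Y.det‖
      linarith
    · exact h
  have hne : ∀ i, ξ i ≠ 0 := fun i h0 => by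
    rw [Finset.prod_eq_zero (Finset.mem_univ i) h0] at hprod
    norm_num at hprod
  set F : Matrix (Fin 4) (Fin 4) ℂ := diagonal (fun i => ((ξ i)⁻¹ : ℝ)) with hF
  have hEF : E * F = 1 := by
    rw [hE, hF, diagonal_mul_diagonal, ← diagonal_one]
    congr 1
    funext i
    rw [← Complex.ofReal_mul, mul_inv_cancel₀ (hne i), Complex.ofReal_one]
  have hconj : ∀ A B : Matrix (Fin 4) (Fin 4) ℂ,
      (P * A * Pᴴ) * (P * B * Pᴴ) = P * (A * B) * Pᴴ := by
    intro A B
    calc (P * A * Pᴴ) * (P * B * Pᴴ) = P * A * (Pᴴ * P) * B * Pᴴ := by simp only [mul_assoc]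
      _ = _ := by rw [hP1]; simp only [mul_assoc, mul_one]
  have hZF : Z = P * F * Pᴴ := by
    have e1 : X * (P * F * Pᴴ) = 1 := by rw [hX, hconj, hEF, mul_one, hP2]
    calc Z = (P * F * Pᴴ) * X * Z := by rw [mul_eq_one_comm.1 e1, one_mul]
      _ = _ := by rw [mul_assoc, hXZ, mul_one]
  have ht1 : trace Z = trace X := by
    rw [hZ, trace_mul_cycle, hU2, one_mul, trace_transpose]
  have ht2 : trace (Z * Z) = trace (X * X) := by
    have : Z * Z = Uᴴ * (X * X)ᵀ * U := by
      calc Z * Z = Uᴴ * Xᵀ * (U * Uᴴ) * Xᵀ * U := by simp only [hZ, mul_assoc]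
        _ = _ := by rw [hU2, transpose_mul X X]; simp only [mul_assoc, one_mul]
    rw [this, trace_mul_cycle, hU2, one_mul, trace_transpose]
  have hs1 : ∑ i, (ξ i)⁻¹ = ∑ i, ξ i := by
    rw [hZF, hX, trace_conj_diagonal hP1, trace_conj_diagonal hP1] at ht1
    exact_mod_cast ht1
  have hs2 : ∑ i, (ξ i)⁻¹ ^ 2 = ∑ i, ξ i ^ 2 := by
    have hsq : ∀ f : Fin 4 → ℝ, diagonal (fun i => (f i : ℂ)) * diagonal (fun i => (f i : ℂ)) =
        diagonal (fun i => ((f i ^ 2 : ℝ) : ℂ)) := by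
      intro f
      rw [diagonal_mul_diagonal]
      congr 1
      funext i
      push_cast
      ring
    rw [hZF, hX, hconj, hconj, hE, hF, hsq, hsq, trace_conj_diagonal hP1,
      trace_conj_diagonal hP1] at ht2
    exact_mod_cast ht2
  have h2 : 0 < ξ 2 := by
    have e1 : E = (Yᴴ * P)ᴴ * D * (Yᴴ * P) := by
      calc E = (Pᴴ * P) * E * (Pᴴ * P) := by rw [hP1]; simp
        _ = Pᴴ * X * P := by rw [hX]; simp only [mul_assoc]
        _ = _ := by simp only [hXdef, conjTranspose_mul, conjTranspose_conjTranspose, mul_assoc]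
    have e2 := nonneg_or_nonneg_of_diagonal_eq e1 (show (2 : Fin 4) ≠ 3 by decide)
    have e3 : ξ 3 ≤ ξ 2 := hξ (by decide)
    exact lt_of_le_of_ne (by rcases e2 with h | h <;> linarith) (hne 2).symm
  simp only [Fin.prod_univ_four, Fin.sum_univ_four] at hprod hs1 hs2
  obtain ⟨a, b, c⟩ := eq_one_of_sum_inv_eq_sum (hξ (show (0 : Fin 4) ≤ 1 by decide))
    (hξ (show (1 : Fin 4) ≤ 2 by decide)) h2 hprod hs1 hs2
  exact ⟨a, b, c, h2⟩

/-- The diagonal of a unitary congruence diagonalizing `BᵀUB` satisfies the quadrilateral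
inequalities when the squared singular values `μ` of `B` satisfy `μ₀ - μ₂ ≤ 2 √(μ₁ μ₃)`. -/
theorem Matrix.two_mul_le_sum_of_congr_diagonal {U W : Matrix (Fin 4) (Fin 4) ℂ} (hUs : Uᵀ = U)
    (hU : U ∈ unitaryGroup (Fin 4) ℂ) {μ s : Fin 4 → ℝ} (hμ : Antitone μ) (hμ0 : 0 ≤ μ 3)
    (hcond : μ 0 - μ 2 ≤ 2 * √(μ 1 * μ 3)) (hs : ∀ i, 0 < s i)
    (hW : W * Wᴴ = diagonal fun i => (μ i : ℂ))
    (hWU : Wᵀ * U * W = diagonal fun i => (s i : ℂ)) (k : Fin 4) :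
    2 * s k ≤ ∑ i, s i := by
  set R : Matrix (Fin 4) (Fin 4) ℂ := diagonal fun i => ((√(s i) : ℝ) : ℂ) with hR
  set R' : Matrix (Fin 4) (Fin 4) ℂ := diagonal fun i => (((√(s i))⁻¹ : ℝ) : ℂ) with hR'
  set D : Matrix (Fin 4) (Fin 4) ℂ := diagonal (fun i => if i = k then (-1 : ℂ) else 1) with hD
  have hRR' : R * R' = 1 := by
    rw [hR, hR', diagonal_mul_diagonal, ← diagonal_one]
    congr 1
    funext i
    rw [← Complex.ofReal_mul, mul_inv_cancel₀ (Real.sqrt_pos.2 (hs i)).ne', Complex.ofReal_one]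
  have hR'R : R' * R = 1 := mul_eq_one_comm.1 hRR'
  have hRR : R * R = diagonal fun i => (s i : ℂ) := by
    rw [hR, diagonal_mul_diagonal]
    congr 1
    funext i
    rw [← Complex.ofReal_mul, Real.mul_self_sqrt (hs i).le]
  have hRt : R'ᵀ = R' := diagonal_transpose _
  have hRh : R'ᴴ = R' := by
    rw [hR', diagonal_conjTranspose]
    congr 1
    funext i
    exact Complex.conj_ofReal _
  have hsh : (diagonal fun i => (s i : ℂ))ᴴ = diagonal fun i => (s i : ℂ) := by
    rw [diagonal_conjTranspose]
    congr 1
    funext i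
    exact Complex.conj_ofReal _
  have hUst : Uᴴᵀ = Uᴴ := by
    rw [← conjTranspose_transpose_comm, hUs]
  have hU1 : Uᴴ * U = 1 := mem_unitaryGroup_iff'.1 hU
  have hU2 : U * Uᴴ = 1 := mem_unitaryGroup_iff.1 hU
  -- Chosen so that both `Yᵀ U Y = 1` and `Yᴴ W = √s`; the latter turns `tr (W Wᴴ Y D Yᴴ)` into `∑
  -- sᵢ - 2 sₖ`.
  set Y := Uᴴ * Wᴴᵀ * R' with hYdef
  have hYh : Yᴴ = R' * Wᵀ * U := by
    rw [hYdef, conjTranspose_mul, conjTranspose_mul, hRh, conjTranspose_conjTranspose,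
      ← conjTranspose_transpose_comm, conjTranspose_conjTranspose, mul_assoc]
  have hY : Yᵀ * U * Y = 1 := by
    have e1 : Wᴴ * Uᴴ * Wᴴᵀ = R * R := by
      rw [hRR, ← hsh, ← hWU]
      simp [conjTranspose_mul, mul_assoc, conjTranspose_transpose_comm]
    calc Yᵀ * U * Y = R' * (Wᴴ * (Uᴴ * U) * Uᴴ * Wᴴᵀ) * R' := by
          simp only [hYdef, transpose_mul, hRt, hUst, transpose_transpose, mul_assoc]
      _ = (R' * R) * (R * R') := by rw [hU1, mul_one, e1]; simp only [mul_assoc]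
      _ = 1 := by rw [hRR', hR'R, mul_one]
  have hYW : Yᴴ * W = R := by
    rw [hYh, mul_assoc, mul_assoc, ← mul_assoc Wᵀ, hWU, ← hRR, ← mul_assoc, hR'R, one_mul]
  have hDh : Dᴴ = D := by
    rw [hD, diagonal_conjTranspose]
    congr 1
    funext i
    simp only [Pi.star_apply]
    split_ifs <;> simp
  have hXh : (Y * D * Yᴴ).IsHermitian := isHermitian_mul_mul_conjTranspose Y hDh
  obtain ⟨P, hP1, hP2, hX⟩ := hXh.exists_eq_mul_diagonal_eigenvalues₀ (k := 4) (by simp)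
  set ξ : Fin 4 → ℝ := fun i => hXh.eigenvalues₀ (Fin.cast (by simp) i) with hξdef
  have hξ : Antitone ξ := fun i j hij => hXh.eigenvalues₀_antitone (by simpa using hij)
  have hP : P ∈ unitaryGroup (Fin 4) ℂ := mem_unitaryGroup_iff.2 hP2
  obtain ⟨h1, h3, h02, h2⟩ := eigenvalues_of_orthogonal_conj hU hY k hP hξ hX
  have htr : trace (diagonal (fun i => (μ i : ℂ)) * (Y * D * Yᴴ)) =
      ((∑ i, s i - 2 * s k : ℝ) : ℂ) := by
    have e1 : Wᴴ * Y = R := by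
      have := congrArg conjTranspose hYW
      rw [conjTranspose_mul, conjTranspose_conjTranspose] at this
      rw [this, hR, diagonal_conjTranspose]
      congr 1
      funext i
      exact Complex.conj_ofReal _
    calc trace (diagonal (fun i => (μ i : ℂ)) * (Y * D * Yᴴ))
        = trace (W * ((Wᴴ * Y) * D * Yᴴ)) := by rw [← hW]; simp only [mul_assoc]
      _ = trace ((R * D) * (Yᴴ * W)) := by rw [trace_mul_comm, e1]; simp only [mul_assoc]
      _ = trace (R * R * D) := by rw [hYW, trace_mul_comm, mul_assoc]
      _ = ∑ i, (s i : ℂ) * (if i = k then (-1 : ℂ) else 1) := by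
          rw [hRR, hD, diagonal_mul_diagonal, trace_diagonal]
      _ = ∑ i, ((s i : ℂ) - if i = k then 2 * (s i : ℂ) else 0) := by
          refine Finset.sum_congr rfl fun i _ => ?_
          split_ifs <;> ring
      _ = _ := by
          rw [Finset.sum_sub_distrib, Finset.sum_ite_eq']
          simp
  -- Opposite ordering pairs `μ 0` with `ξ 3 = -1` and `μ 2` with `ξ 1 = 1`; the other two terms are
  -- handled by AM-GM, since `ξ 0 * ξ 2 = 1`.
  have hle := sum_mul_rev_le_re_trace hμ hξ hP
  rw [← hX, htr, Complex.ofReal_re, Fin.sum_univ_four] at hle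
  have r0 : (0 : Fin 4).rev = 3 := rfl
  have r1 : (1 : Fin 4).rev = 2 := rfl
  have r2 : (2 : Fin 4).rev = 1 := rfl
  have r3 : (3 : Fin 4).rev = 0 := rfl
  rw [r0, r1, r2, r3, h1, h3] at hle
  have h0 : 0 < ξ 0 := h2.trans_le (hξ (by decide))
  have hμ1 : 0 ≤ μ 1 := hμ0.trans (hμ (by decide))
  have hamgm : 2 * √(μ 1 * μ 3) ≤ μ 1 * ξ 2 + μ 3 * ξ 0 := by
    have e1 : √(μ 1 * μ 3) = √(μ 1 * ξ 2) * √(μ 3 * ξ 0) := by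
      rw [← Real.sqrt_mul (by positivity)]
      congr 1
      linear_combination -(μ 1 * μ 3) * h02
    rw [e1]
    have e2 := Real.sq_sqrt (show 0 ≤ μ 1 * ξ 2 by positivity)
    have e3 := Real.sq_sqrt (show 0 ≤ μ 3 * ξ 0 by positivity)
    nlinarith [sq_nonneg (√(μ 1 * ξ 2) - √(μ 3 * ξ 0))]
  linarith

/-! ### Closing the quadrilateral and clearing the diagonal -/

/-- Triangle closing: two sides `a`, `b` can be rotated to sum to `d`. -/
theorem Complex.exists_norm_eq_one_mul_add_mul_eq {a b d : ℝ} (h1 : |a - b| ≤ d) (h2 : d ≤ a + b) :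
    ∃ u v : ℂ, ‖u‖ = 1 ∧ ‖v‖ = 1 ∧ a * u + b * v = d := by
  have hd : 0 ≤ d := (abs_nonneg _).trans h1
  have hcont : ContinuousOn (fun θ : ℝ => ‖(a : ℂ) + b * Complex.exp (θ * Complex.I)‖)
      (Set.Icc 0 Real.pi) := by fun_prop
  have hmem : d ∈ Set.Icc ((fun θ : ℝ => ‖(a : ℂ) + b * Complex.exp (θ * Complex.I)‖) Real.pi)
      ((fun θ : ℝ => ‖(a : ℂ) + b * Complex.exp (θ * Complex.I)‖) 0) := by
    constructor
    · simpa [← sub_eq_add_neg, ← Complex.ofReal_sub] using h1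
    · simp only [Complex.ofReal_zero, zero_mul, Complex.exp_zero, mul_one, ← Complex.ofReal_add,
        Complex.norm_real, Real.norm_eq_abs]
      exact h2.trans (le_abs_self _)
  obtain ⟨θ, -, hθ⟩ := intermediate_value_Icc' Real.pi_pos.le hcont hmem
  set z : ℂ := a + b * Complex.exp (θ * Complex.I) with hz
  simp only at hθ
  obtain ⟨w, hw1, hw2⟩ : ∃ w : ℂ, ‖w‖ = 1 ∧ w * z = ‖z‖ := by
    refine ⟨Complex.exp ((-z.arg : ℝ) * Complex.I), Complex.norm_exp_ofReal_mul_I _, ?_⟩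
    have h : Complex.exp ((-z.arg : ℝ) * Complex.I) * Complex.exp (z.arg * Complex.I) = 1 := by
      rw [← Complex.exp_add, ← Complex.exp_zero]
      congr 1
      push_cast
      ring
    nth_rw 2 [← Complex.norm_mul_exp_arg_mul_I z]
    linear_combination (‖z‖ : ℂ) * h
  refine ⟨w, w * Complex.exp (θ * Complex.I), hw1, ?_, ?_⟩
  · rw [norm_mul, hw1, Complex.norm_exp_ofReal_mul_I, one_mul]
  · rw [← hθ, ← hw2, hz]
    ring

/-- Quadrilateral closing. -/
theorem Complex.exists_norm_eq_one_sum_mul_eq_zero {s : Fin 4 → ℝ} (hs : ∀ i, 0 ≤ s i)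
    (h : ∀ k, 2 * s k ≤ ∑ i, s i) :
    ∃ u : Fin 4 → ℂ, (∀ i, ‖u i‖ = 1) ∧ ∑ i, s i * u i = 0 := by
  simp only [Fin.sum_univ_four] at h
  have h0 := h 0
  have h1 := h 1
  have h2 := h 2
  have h3 := h 3
  have p0 := hs 0
  have p1 := hs 1
  have p2 := hs 2
  have p3 := hs 3
  -- A diagonal cuts the quadrilateral into two triangles; `d` is the least length allowed by both
  -- lower triangle inequalities.
  set d := max |s 0 - s 1| |s 2 - s 3| with hd
  have hd1 : d ≤ s 0 + s 1 := by
    refine max_le ?_ ?_ <;> rw [abs_le] <;> constructor <;> linarith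
  have hd2 : d ≤ s 2 + s 3 := by
    refine max_le ?_ ?_ <;> rw [abs_le] <;> constructor <;> linarith
  obtain ⟨u, v, hu, hv, e1⟩ := exists_norm_eq_one_mul_add_mul_eq (le_max_left _ _) hd1
  obtain ⟨u', v', hu', hv', e2⟩ := exists_norm_eq_one_mul_add_mul_eq (le_max_right _ _) hd2
  refine ⟨![u, v, -u', -v'], ?_, ?_⟩
  · intro i
    fin_cases i <;> simp [*]
  · rw [Fin.sum_univ_four]
    simp only [cons_val]
    linear_combination e1 - e2

/-- A `4 × 4` Hadamard matrix, normalized to be unitary. -/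
def hadamardFour : Matrix (Fin 4) (Fin 4) ℂ :=
  (1 / 2 : ℂ) • !![1, 1, 1, 1; 1, -1, 1, -1; 1, 1, -1, -1; 1, -1, -1, 1]

theorem hadamardFour_mem_unitaryGroup : hadamardFour ∈ unitaryGroup (Fin 4) ℂ := by
  have h : (starRingEnd ℂ) 2 = 2 := map_ofNat _ 2
  rw [mem_unitaryGroup_iff]
  ext i j
  fin_cases i <;> fin_cases j <;>
    simp [hadamardFour, mul_apply, Fin.sum_univ_four, h] <;> norm_num

/-- Because of this, `Hᵀ Δ H` with `Δ` diagonal has every diagonal entry equal to the mean of the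
entries of `Δ`. -/
theorem hadamardFour_mul_self (i j : Fin 4) : hadamardFour i j * hadamardFour i j = 1 / 4 := by
  fin_cases i <;> fin_cases j <;> simp [hadamardFour] <;> norm_num

theorem Matrix.exists_unitary_diag_congr_eq_zero_of_pos {U : Matrix (Fin 4) (Fin 4) ℂ}
    (hUs : Uᵀ = U) (hU : U ∈ unitaryGroup (Fin 4) ℂ) {μ : Fin 4 → ℝ} (hμ : Antitone μ)
    (hμ0 : 0 < μ 3) (hcond : μ 0 - μ 2 ≤ 2 * √(μ 1 * μ 3)) :
    ∃ V ∈ unitaryGroup (Fin 4) ℂ, ∀ j,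
      ((diagonal (fun i => ((√(μ i) : ℝ) : ℂ)) * V)ᵀ * U *
        (diagonal (fun i => ((√(μ i) : ℝ) : ℂ)) * V)) j j = 0 := by
  set B : Matrix (Fin 4) (Fin 4) ℂ := diagonal (fun i => ((√(μ i) : ℝ) : ℂ)) with hB
  have hμp : ∀ i, 0 < μ i := fun i => hμ0.trans_le (hμ (Fin.le_last i))
  have hBt : Bᵀ = B := diagonal_transpose _
  obtain ⟨V, hV, s, hs, hVs⟩ := exists_takagi (M := B * U * B) (by
    simp [hBt, hUs, mul_assoc])
  have hWU : (B * V)ᵀ * U * (B * V) = diagonal fun i => (s i : ℂ) := by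
    rw [← hVs]
    simp [hBt, mul_assoc]
  have hW : (B * V) * (B * V)ᴴ = diagonal fun i => (μ i : ℂ) := by
    have h1 : V * Vᴴ = 1 := mem_unitaryGroup_iff.1 hV
    rw [conjTranspose_mul, mul_assoc, ← mul_assoc V, h1, one_mul, hB, diagonal_conjTranspose,
      diagonal_mul_diagonal]
    congr 1
    funext i
    rw [Pi.star_apply, RCLike.star_def, Complex.conj_ofReal, ← Complex.ofReal_mul,
      Real.mul_self_sqrt (hμp i).le]
  have hspos : ∀ i, 0 < s i := by
    have hdet : ((B * V)ᵀ * U * (B * V)).det ≠ 0 := by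
      have hdB : B.det ≠ 0 := by
        rw [hB, det_diagonal]
        exact Finset.prod_ne_zero_iff.2 fun i _ =>
          Complex.ofReal_ne_zero.2 (Real.sqrt_pos.2 (hμp i)).ne'
      have hdet' : ∀ A ∈ unitaryGroup (Fin 4) ℂ, A.det ≠ 0 := fun A hA h0 => by
        have := congrArg det (mem_unitaryGroup_iff.1 hA)
        rw [det_mul, h0, zero_mul, det_one] at this
        exact zero_ne_one this
      simp only [det_mul, det_transpose]
      have := hdet' V hV
      have := hdet' U hU
      positivity
    rw [hWU, det_diagonal] at hdet
    intro i
    have := Finset.prod_ne_zero_iff.1 hdet i (Finset.mem_univ i)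
    exact lt_of_le_of_ne (hs i) (Complex.ofReal_ne_zero.1 this).symm
  obtain ⟨u, hu, hsum⟩ := Complex.exists_norm_eq_one_sum_mul_eq_zero hs
    (two_mul_le_sum_of_congr_diagonal hUs hU hμ hμ0.le hcond hspos hW hWU)
  -- Square roots, because a transpose congruence applies each phase twice.
  choose w hw using fun i => IsAlgClosed.exists_pow_nat_eq (u i) two_pos
  have hwn : ∀ i, ‖w i‖ = 1 := by
    intro i
    have h1 : ‖w i‖ ^ 2 = 1 := by rw [← norm_pow, hw, hu]
    exact (pow_eq_one_iff_of_nonneg (norm_nonneg _) two_ne_zero).1 h1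
  have hwU : diagonal w ∈ unitaryGroup (Fin 4) ℂ := by
    rw [mem_unitaryGroup_iff', star_eq_conjTranspose, diagonal_conjTranspose, diagonal_mul_diagonal,
      ← diagonal_one]
    congr 1
    funext i
    simpa [hwn i] using Complex.conj_mul' (w i)
  refine ⟨V * (diagonal w * hadamardFour),
    mul_mem hV (mul_mem hwU hadamardFour_mem_unitaryGroup), fun j => ?_⟩
  have h1 : (B * (V * (diagonal w * hadamardFour)))ᵀ * U * (B * (V * (diagonal w * hadamardFour)))
      = hadamardFourᵀ * (diagonal w * ((B * V)ᵀ * U * (B * V)) * diagonal w * hadamardFour) := by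
    simp only [transpose_mul, diagonal_transpose, mul_assoc]
  have h2 : diagonal w * ((B * V)ᵀ * U * (B * V)) * diagonal w = diagonal fun i => s i * u i := by
    rw [hWU, diagonal_mul_diagonal, diagonal_mul_diagonal]
    congr 1
    funext i
    rw [← hw i]
    ring
  rw [h1, h2, mul_apply]
  have h3 : ∀ i, hadamardFourᵀ j i * ((diagonal fun i => s i * u i) * hadamardFour) i j =
      1 / 4 * (s i * u i) := by
    intro i
    rw [diagonal_mul, transpose_apply]
    linear_combination (s i * u i) * hadamardFour_mul_self i j
  simp_rw [h3]
  rw [← Finset.mul_sum, hsum, mul_zero]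

/-- Projection along a compact factor is closed, so the set of solvable `t` is closed and contains
the limit point `0`. This extends the diagonal lemma to a singular spectrum. -/
theorem IsCompact.exists_eq_of_forall_pos {X Y : Type*} [TopologicalSpace X] [TopologicalSpace Y]
    [T1Space Y] {K : Set X} (hK : IsCompact K) {F : ℝ → X → Y}
    (hF : Continuous fun p : ℝ × X => F p.1 p.2) {c : Y} (h : ∀ t > 0, ∃ x ∈ K, F t x = c) :
    ∃ x ∈ K, F 0 x = c := by
  have : CompactSpace K := isCompact_iff_compactSpace.1 hK
  set C : Set (ℝ × K) := {p | F p.1 p.2 = c} with hC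
  have hCc : IsClosed C := isClosed_singleton.preimage
    (hF.comp (continuous_fst.prodMk (continuous_subtype_val.comp continuous_snd)))
  have hcl : IsClosed (Prod.fst '' C) := isClosedMap_fst_of_compactSpace C hCc
  have hsub : Set.Ioi (0 : ℝ) ⊆ Prod.fst '' C := by
    intro t ht
    obtain ⟨x, hx, hxc⟩ := h t ht
    exact ⟨⟨t, x, hx⟩, hxc, rfl⟩
  have h0 : (0 : ℝ) ∈ Prod.fst '' C := hcl.closure_subset_iff.2 hsub (by simp)
  obtain ⟨⟨t, x, hx⟩, hxC, rfl⟩ := h0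
  exact ⟨x, hx, hxC⟩

theorem Matrix.exists_unitary_diag_congr_eq_zero {U : Matrix (Fin 4) (Fin 4) ℂ}
    (hUs : Uᵀ = U) (hU : U ∈ unitaryGroup (Fin 4) ℂ) {μ : Fin 4 → ℝ} (hμ : Antitone μ)
    (hμ0 : 0 ≤ μ 3) (hcond : μ 0 - μ 2 ≤ 2 * √(μ 1 * μ 3)) :
    ∃ V ∈ unitaryGroup (Fin 4) ℂ, ∀ j,
      ((diagonal (fun i => ((√(μ i) : ℝ) : ℂ)) * V)ᵀ * U *
        (diagonal (fun i => ((√(μ i) : ℝ) : ℂ)) * V)) j j = 0 := by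
  set F : ℝ → Matrix (Fin 4) (Fin 4) ℂ → Fin 4 → ℂ := fun t V =>
    ((diagonal (fun i => ((√(μ i + t) : ℝ) : ℂ)) * V)ᵀ * U *
        (diagonal (fun i => ((√(μ i + t) : ℝ) : ℂ)) * V)).diag with hF
  have hFc : Continuous fun p : ℝ × Matrix (Fin 4) (Fin 4) ℂ => F p.1 p.2 := by
    simp only [hF]
    fun_prop
  -- Shifting `μ` by `t > 0` makes it positive, keeps `μ 0 - μ 2` and increases the square root.
  obtain ⟨V, hV, hVd⟩ := isCompact_unitaryGroup.exists_eq_of_forall_pos hFc (c := 0) (by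
    intro t ht
    obtain ⟨V, hV, hVd⟩ := exists_unitary_diag_congr_eq_zero_of_pos hUs hU
      (μ := fun i => μ i + t) (fun i j hij => by simpa using hμ hij) (by positivity) (by
        have : √(μ 1 * μ 3) ≤ √((μ 1 + t) * (μ 3 + t)) := by
          have hμ1 : 0 ≤ μ 1 := hμ0.trans (hμ (by decide))
          gcongr <;> linarith
        linarith)
    exact ⟨V, hV, funext hVd⟩)
  refine ⟨V, hV, fun j => ?_⟩
  simpa [hF] using congrFun hVd j

/-! ### Product vectors and separable decompositions -/

theorem exists_isState (m : Type*) [Fintype m] [Nonempty m] :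
    ∃ a : Matrix m m ℂ, IsState a := by
  classical
  obtain ⟨i⟩ := ‹Nonempty m›
  refine ⟨vecMulVec (Pi.single i 1) (star (Pi.single i 1)), posSemidef_vecMulVec_self_star _, ?_⟩
  rw [trace_vecMulVec]
  simp

theorem exists_isState_smul_eq_vecMulVec {m : Type*} [Fintype m] [Nonempty m] (a : m → ℂ) :
    ∃ (r : ℝ) (ρ : Matrix m m ℂ), 0 ≤ r ∧ IsState ρ ∧ vecMulVec a (star a) = r • ρ := by
  set r : ℝ := ∑ i, ‖a i‖ ^ 2 with hr
  have hr0 : 0 ≤ r := by positivity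
  have htr : trace (vecMulVec a (star a)) = (r : ℂ) := by
    rw [trace_vecMulVec, dotProduct, hr]
    push_cast
    exact Finset.sum_congr rfl fun i _ => Complex.mul_conj' (a i)
  rcases hr0.eq_or_lt with h | h
  · obtain ⟨ρ, hρ⟩ := exists_isState m
    refine ⟨0, ρ, le_rfl, hρ, ?_⟩
    have : a = 0 := by
      funext i
      have := (Finset.sum_eq_zero_iff_of_nonneg (fun i _ => by positivity)).1 h.symm i
        (Finset.mem_univ i)
      simpa using this
    simp [this]
  · refine ⟨r, r⁻¹ • vecMulVec a (star a), hr0, ⟨?_, ?_⟩, ?_⟩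
    · exact (posSemidef_vecMulVec_self_star a).smul (inv_nonneg.2 hr0)
    · rw [trace_smul, htr, Complex.real_smul, ← Complex.ofReal_mul, inv_mul_cancel₀ h.ne',
        Complex.ofReal_one]
    · rw [smul_smul, mul_inv_cancel₀ h.ne', one_smul]

theorem trace_eq_one_of_mem_separableStates {m n : Type*} [Fintype m] [Fintype n]
    {ρ : Matrix (m × n) (m × n) ℂ} (h : ρ ∈ separableStates m n) : ρ.trace = 1 := by
  have hconv : Convex ℝ {ρ : Matrix (m × n) (m × n) ℂ | ρ.trace = 1} := by
    intro x hx y hy a b _ _ hab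
    simp only [Set.mem_ofPred_eq] at hx hy ⊢
    rw [trace_add, trace_smul, trace_smul, hx, hy, ← add_smul, hab, one_smul]
  refine convexHull_min ?_ hconv h
  rintro _ ⟨a, b, ha, hb, rfl⟩
  rw [Set.mem_ofPred_eq, trace_kronecker, ha.2, hb.2, one_mul]

/-- A two-qubit vector with vanishing concurrence is a product vector. -/
theorem exists_eq_mul_of_det_eq_zero {z : Fin 2 × Fin 2 → ℂ}
    (h : z (0, 0) * z (1, 1) = z (0, 1) * z (1, 0)) :
    ∃ a b : Fin 2 → ℂ, ∀ p, z p = a p.1 * b p.2 := by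
  by_cases h0 : z (0, 0) = 0
  · rw [h0, zero_mul] at h
    rcases mul_eq_zero.1 h.symm with h1 | h1
    · refine ⟨![0, 1], ![z (1, 0), z (1, 1)], ?_⟩
      rintro ⟨i, j⟩
      fin_cases i <;> fin_cases j <;> simp [h0, h1]
    · refine ⟨![z (0, 1), z (1, 1)], ![0, 1], ?_⟩
      rintro ⟨i, j⟩
      fin_cases i <;> fin_cases j <;> simp [h0, h1]
  · refine ⟨![1, z (1, 0) / z (0, 0)], ![z (0, 0), z (0, 1)], ?_⟩
    rintro ⟨i, j⟩
    fin_cases i <;> fin_cases j <;> simp [h0]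
    rw [div_mul_eq_mul_div, eq_div_iff h0]
    linear_combination h

theorem exists_smul_eq_vecMulVec_of_det_eq_zero {z : Fin 2 × Fin 2 → ℂ}
    (h : z (0, 0) * z (1, 1) = z (0, 1) * z (1, 0)) :
    ∃ (r : ℝ) (ρ : Matrix (Fin 2 × Fin 2) (Fin 2 × Fin 2) ℂ), 0 ≤ r ∧
      ρ ∈ separableStates (Fin 2) (Fin 2) ∧ vecMulVec z (star z) = r • ρ := by
  obtain ⟨a, b, hab⟩ := exists_eq_mul_of_det_eq_zero h
  obtain ⟨r, ρ, hr, hρ, h1⟩ := exists_isState_smul_eq_vecMulVec a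
  obtain ⟨t, τ, ht, hτ, h2⟩ := exists_isState_smul_eq_vecMulVec b
  refine ⟨r * t, ρ ⊗ₖ τ, mul_nonneg hr ht, subset_convexHull ℝ _ ⟨ρ, τ, hρ, hτ, rfl⟩, ?_⟩
  have h3 : vecMulVec z (star z) = vecMulVec a (star a) ⊗ₖ vecMulVec b (star b) := by
    ext p q
    simp only [vecMulVec_apply, kroneckerMap_apply, Pi.star_apply, hab, star_mul']
    ring
  rw [h3, h1, h2, smul_kronecker, kronecker_smul, smul_smul]

/-- `W Wᴴ` is the sum of the rank-one matrices of the columns of `W`, each a nonnegative multiple of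
a separable state; the trace condition makes the weights sum to one. -/
theorem mem_separableStates_of_eq_mul_conjTranspose {k : Type*} [Fintype k]
    {A : Matrix (Fin 2 × Fin 2) (Fin 2 × Fin 2) ℂ} {W : Matrix (Fin 2 × Fin 2) k ℂ}
    (hA : A = W * Wᴴ) (htr : A.trace = 1)
    (hW : ∀ j, W (0, 0) j * W (1, 1) j = W (0, 1) j * W (1, 0) j) :
    A ∈ separableStates (Fin 2) (Fin 2) := by
  choose r ρ hr hρ hz using fun j =>
    exists_smul_eq_vecMulVec_of_det_eq_zero (z := fun p => W p j) (hW j)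
  have hsum : A = ∑ j, r j • ρ j := by
    simp_rw [← hz]
    rw [hA]
    ext p q
    simp [mul_apply, Matrix.sum_apply, vecMulVec_apply]
  have hr1 : ∑ j, r j = 1 := by
    rw [hsum, trace_sum] at htr
    simp_rw [trace_smul, trace_eq_one_of_mem_separableStates (hρ _), Complex.real_smul,
      mul_one] at htr
    exact_mod_cast htr
  rw [hsum]
  exact (convex_convexHull ℝ _).sum_mem (fun j _ => hr j) hr1 fun j _ => hρ j

/-! ### Sufficiency of the spectral criterion -/

/-- The spin flip matrix `σ_y ⊗ σ_y` (up to sign). -/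
def spinFlip : Matrix (Fin 2 × Fin 2) (Fin 2 × Fin 2) ℂ :=
  !![0, 1; -1, 0] ⊗ₖ !![0, 1; -1, 0]

theorem spinFlip_transpose : spinFlipᵀ = spinFlip := by
  ext ⟨i, j⟩ ⟨k, l⟩
  fin_cases i <;> fin_cases j <;> fin_cases k <;> fin_cases l <;> simp [spinFlip]

theorem spinFlip_conjTranspose : spinFlipᴴ = spinFlip := by
  ext ⟨i, j⟩ ⟨k, l⟩
  fin_cases i <;> fin_cases j <;> fin_cases k <;> fin_cases l <;> simp [spinFlip]

theorem spinFlip_mul_self : spinFlip * spinFlip = 1 := by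
  rw [spinFlip, ← mul_kronecker_mul]
  have : (!![0, 1; -1, 0] * !![0, 1; -1, 0] : Matrix (Fin 2) (Fin 2) ℂ) = -1 := by
    ext i j
    fin_cases i <;> fin_cases j <;> simp
  rw [this]
  ext ⟨i, j⟩ ⟨k, l⟩
  fin_cases i <;> fin_cases j <;> fin_cases k <;> fin_cases l <;> simp

/-- The spin flip polarizes the `2 × 2` determinant, so columns being product vectors becomes a
condition on the diagonal of a symmetric matrix. -/
theorem transpose_mul_spinFlip_mul_apply_self {k : Type*} (W : Matrix (Fin 2 × Fin 2) k ℂ)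
    (j : k) : (Wᵀ * spinFlip * W) j j =
      2 * (W (0, 0) j * W (1, 1) j - W (0, 1) j * W (1, 0) j) := by
  simp [mul_apply, Fintype.sum_prod_type, spinFlip]
  ring

/-- A two-qubit state with eigenvalues `μ₀ ≥ μ₁ ≥ μ₂ ≥ μ₃` and `μ₀ - μ₂ ≤ 2 √(μ₁ μ₃)` is
separable. -/
theorem mul_diagonal_mul_mem_separableStates {P : Matrix (Fin 2 × Fin 2) (Fin 4) ℂ}
    (hP1 : Pᴴ * P = 1) (hP2 : P * Pᴴ = 1) {μ : Fin 4 → ℝ} (hμ : Antitone μ) (hμ0 : 0 ≤ μ 3)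
    (hμ1 : ∑ i, μ i = 1) (hcond : μ 0 - μ 2 ≤ 2 * √(μ 1 * μ 3)) :
    P * diagonal (fun i => (μ i : ℂ)) * Pᴴ ∈ separableStates (Fin 2) (Fin 2) := by
  set U := Pᵀ * spinFlip * P with hUdef
  have hUs : Uᵀ = U := by
    simp only [hUdef, transpose_mul, transpose_transpose, spinFlip_transpose, Matrix.mul_assoc]
  have hU : U ∈ unitaryGroup (Fin 4) ℂ := by
    rw [mem_unitaryGroup_iff', star_eq_conjTranspose]
    have h1 : Pᵀᴴ * Pᵀ = 1 := by
      rw [conjTranspose_transpose_comm, ← transpose_mul, hP2, transpose_one]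
    calc Uᴴ * U = Pᴴ * spinFlip * (Pᵀᴴ * Pᵀ) * spinFlip * P := by
          simp only [hUdef, conjTranspose_mul, spinFlip_conjTranspose, Matrix.mul_assoc]
      _ = Pᴴ * (spinFlip * spinFlip) * P := by rw [h1, Matrix.mul_one]; simp only [Matrix.mul_assoc]
      _ = 1 := by rw [spinFlip_mul_self, Matrix.mul_one, hP1]
  obtain ⟨V, hV, hVd⟩ := exists_unitary_diag_congr_eq_zero hUs hU hμ hμ0 hcond
  set B : Matrix (Fin 4) (Fin 4) ℂ := diagonal (fun i => ((√(μ i) : ℝ) : ℂ)) with hB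
  have hBB : B * Bᴴ = diagonal fun i => (μ i : ℂ) := by
    rw [hB, diagonal_conjTranspose, diagonal_mul_diagonal]
    congr 1
    funext i
    rw [Pi.star_apply, RCLike.star_def, Complex.conj_ofReal, ← Complex.ofReal_mul,
      Real.mul_self_sqrt (hμ0.trans (hμ (Fin.le_last i)))]
  refine mem_separableStates_of_eq_mul_conjTranspose (W := P * (B * V)) ?_ ?_ fun j => ?_
  · have hV2 : V * Vᴴ = 1 := mem_unitaryGroup_iff.1 hV
    rw [← hBB]
    calc P * (B * Bᴴ) * Pᴴ = P * B * (V * Vᴴ) * Bᴴ * Pᴴ := by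
          rw [hV2, Matrix.mul_one]; simp only [Matrix.mul_assoc]
      _ = _ := by simp only [conjTranspose_mul, Matrix.mul_assoc]
  · rw [trace_conj_diagonal hP1, hμ1, Complex.ofReal_one]
  · have h1 := transpose_mul_spinFlip_mul_apply_self (P * (B * V)) j
    have h2 : (P * (B * V))ᵀ * spinFlip * (P * (B * V)) = (B * V)ᵀ * U * (B * V) := by
      simp only [hUdef, transpose_mul, Matrix.mul_assoc]
    rw [h2, hVd j] at h1
    linear_combination -(1 / 2) * h1

theorem isState_mul_diagonal_mul {n k : Type*} [Fintype n] [Fintype k] [DecidableEq k]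
    {P : Matrix n k ℂ} (hP : Pᴴ * P = 1) {μ : k → ℝ} (hμ : ∀ i, 0 ≤ μ i) (hμ1 : ∑ i, μ i = 1) :
    IsState (P * diagonal (fun i => (μ i : ℂ)) * Pᴴ) := by
  refine ⟨?_, by rw [trace_conj_diagonal hP, hμ1, Complex.ofReal_one]⟩
  exact (posSemidef_diagonal_iff.2 fun i => Complex.zero_le_real.2 (hμ i)).mul_mul_conjTranspose_same
    P

/-- Sufficiency of the spectral criterion for absolute separability of two qubits. -/
theorem mul_diagonal_mul_mem_absSepStates {P : Matrix (Fin 2 × Fin 2) (Fin 4) ℂ}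
    (hP1 : Pᴴ * P = 1) (hP2 : P * Pᴴ = 1) {μ : Fin 4 → ℝ} (hμ : Antitone μ) (hμ0 : 0 ≤ μ 3)
    (hμ1 : ∑ i, μ i = 1) (hcond : μ 0 - μ 2 ≤ 2 * √(μ 1 * μ 3)) :
    P * diagonal (fun i => (μ i : ℂ)) * Pᴴ ∈ absSepStates (Fin 2) (Fin 2) := by
  refine ⟨isState_mul_diagonal_mul hP1 (fun i => hμ0.trans (hμ (Fin.le_last i))) hμ1,
    fun U hU => ?_⟩
  have h1 : Uᴴ * U = 1 := mem_unitaryGroup_iff'.1 hU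
  have h2 : U * Uᴴ = 1 := mem_unitaryGroup_iff.1 hU
  have h3 : U * (P * diagonal (fun i => (μ i : ℂ)) * Pᴴ) * star U =
      (U * P) * diagonal (fun i => (μ i : ℂ)) * (U * P)ᴴ := by
    simp only [conjTranspose_mul, Matrix.mul_assoc, star_eq_conjTranspose]
  rw [h3]
  refine mul_diagonal_mul_mem_separableStates ?_ ?_ hμ hμ0 hμ1 hcond
  · calc (U * P)ᴴ * (U * P) = Pᴴ * (Uᴴ * U) * P := by simp only [conjTranspose_mul, Matrix.mul_assoc]
      _ = 1 := by rw [h1, Matrix.mul_one, hP1]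
  · calc (U * P) * (U * P)ᴴ = U * (P * Pᴴ) * Uᴴ := by simp only [conjTranspose_mul, Matrix.mul_assoc]
      _ = 1 := by rw [hP2, Matrix.mul_one, h2]

/-! ### Necessity of the spectral criterion -/

/-- Positivity of the partial transpose of a separable state on the span of `|01⟩` and `|10⟩`. -/
theorem nonneg_of_mem_separableStates {ρ : Matrix (Fin 2 × Fin 2) (Fin 2 × Fin 2) ℂ}
    (h : ρ ∈ separableStates (Fin 2) (Fin 2)) (x y : ℝ) :
    0 ≤ x ^ 2 * (ρ (0, 1) (0, 1)).re + y ^ 2 * (ρ (1, 0) (1, 0)).re +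
      2 * x * y * (ρ (0, 0) (1, 1)).re := by
  set f : Matrix (Fin 2 × Fin 2) (Fin 2 × Fin 2) ℂ → ℝ := fun ρ =>
    x ^ 2 * (ρ (0, 1) (0, 1)).re + y ^ 2 * (ρ (1, 0) (1, 0)).re +
      2 * x * y * (ρ (0, 0) (1, 1)).re with hf
  have hconv : Convex ℝ {ρ | 0 ≤ f ρ} := by
    intro ρ hρ τ hτ a b ha hb _
    have h1 : f (a • ρ + b • τ) = a * f ρ + b * f τ := by
      simp [hf]
      ring
    rw [Set.mem_ofPred_eq, h1]
    exact add_nonneg (mul_nonneg ha hρ) (mul_nonneg hb hτ)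
  refine convexHull_min ?_ hconv h
  rintro _ ⟨a, b, ha, hb, rfl⟩
  -- Partial transposition moves the `(00, 11)` entry of `a ⊗ b` to position `(01, 10)` of `a ⊗ bᵀ`.
  have hpsd := (ha.1.kronecker hb.1.transpose).dotProduct_mulVec_nonneg
    (fun p => if p = (0, 1) then (x : ℂ) else if p = (1, 0) then (y : ℂ) else 0)
  have hre := (Complex.le_def.1 hpsd).1
  have hsa : a 1 0 = star (a 0 1) := (ha.1.isHermitian.apply 1 0).symm
  have hsb : b 1 0 = star (b 0 1) := (hb.1.isHermitian.apply 1 0).symm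
  simp [dotProduct, mulVec, Fintype.sum_prod_type, hsa, hsb] at hre
  simp only [Set.mem_ofPred_eq, hf, kroneckerMap_apply, Complex.mul_re]
  linarith

/-- A unitary matrix whose columns are two Bell states and two product states. -/
def bellBasis : Matrix (Fin 2 × Fin 2) (Fin 4) ℂ :=
  of fun p => ![![![((√2 : ℝ) : ℂ)⁻¹, 0, ((√2 : ℝ) : ℂ)⁻¹, 0], ![0, 1, 0, 0]],
    ![![0, 0, 0, 1], ![((√2 : ℝ) : ℂ)⁻¹, 0, -((√2 : ℝ) : ℂ)⁻¹, 0]]] p.1 p.2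

theorem sqrt_two_inv_mul_self : ((√2 : ℝ) : ℂ)⁻¹ * ((√2 : ℝ) : ℂ)⁻¹ = 1 / 2 := by
  rw [← mul_inv, ← Complex.ofReal_mul, Real.mul_self_sqrt (by norm_num)]
  norm_num

theorem bellBasis_mul_conjTranspose_self : bellBasis * bellBasisᴴ = 1 := by
  have h := sqrt_two_inv_mul_self
  ext ⟨i, j⟩ ⟨k, l⟩
  fin_cases i <;> fin_cases j <;> fin_cases k <;> fin_cases l <;>
    simp [bellBasis, mul_apply, Fin.sum_univ_four, h] <;> norm_num

/-- Necessity of the spectral criterion for absolute separability of two qubits. -/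
theorem sq_le_of_mem_absSepStates {P : Matrix (Fin 2 × Fin 2) (Fin 4) ℂ}
    (hP1 : Pᴴ * P = 1) {μ : Fin 4 → ℝ} (hμ1 : 0 < μ 1)
    (h : P * diagonal (fun i => (μ i : ℂ)) * Pᴴ ∈ absSepStates (Fin 2) (Fin 2)) :
    (μ 0 - μ 2) ^ 2 ≤ 4 * (μ 1 * μ 3) := by
  -- This unitary sends the eigenvectors of `μ 0`, `μ 2` to Bell states and those of `μ 1`, `μ 3` to
  -- `|01⟩`, `|10⟩`.
  have hU : bellBasis * Pᴴ ∈ unitaryGroup (Fin 2 × Fin 2) ℂ := by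
    rw [mem_unitaryGroup_iff, star_eq_conjTranspose]
    calc bellBasis * Pᴴ * (bellBasis * Pᴴ)ᴴ = bellBasis * (Pᴴ * P) * bellBasisᴴ := by
          simp only [conjTranspose_mul, conjTranspose_conjTranspose, Matrix.mul_assoc]
      _ = 1 := by rw [hP1, Matrix.mul_one, bellBasis_mul_conjTranspose_self]
  have hsep := h.2 _ hU
  have heq : bellBasis * Pᴴ * (P * diagonal (fun i => (μ i : ℂ)) * Pᴴ) * star (bellBasis * Pᴴ)
      = bellBasis * diagonal (fun i => (μ i : ℂ)) * bellBasisᴴ := by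
    calc _ = bellBasis * (Pᴴ * P) * diagonal (fun i => (μ i : ℂ)) * (Pᴴ * P) * bellBasisᴴ := by
          simp only [star_eq_conjTranspose, conjTranspose_mul, conjTranspose_conjTranspose,
            Matrix.mul_assoc]
      _ = _ := by rw [hP1, Matrix.mul_one, Matrix.mul_one]
  rw [heq] at hsep
  have h1 : (bellBasis * diagonal (fun i => (μ i : ℂ)) * bellBasisᴴ) (0, 1) (0, 1) = μ 1 := by
    simp [mul_apply, Fin.sum_univ_four, bellBasis]
  have h2 : (bellBasis * diagonal (fun i => (μ i : ℂ)) * bellBasisᴴ) (1, 0) (1, 0) = μ 3 := by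
    simp [mul_apply, Fin.sum_univ_four, bellBasis]
  have h3 : (bellBasis * diagonal (fun i => (μ i : ℂ)) * bellBasisᴴ) (0, 0) (1, 1) =
      (((μ 0 - μ 2) / 2 : ℝ) : ℂ) := by
    simp [mul_apply, Fin.sum_univ_four, bellBasis]
    linear_combination (μ 0 - μ 2 : ℂ) * sqrt_two_inv_mul_self
  -- For `y = 2 μ 1` this `x` minimizes the quadratic form, with value `μ 1 * (4 μ 1 μ 3 - (μ 0 - μ
  -- 2)²)`.
  have h4 := nonneg_of_mem_separableStates hsep (-(μ 0 - μ 2)) (2 * μ 1)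
  rw [h1, h2, h3, Complex.ofReal_re, Complex.ofReal_re, Complex.ofReal_re] at h4
  have h5 : 0 ≤ μ 1 * (4 * (μ 1 * μ 3) - (μ 0 - μ 2) ^ 2) := by linarith
  linarith [nonneg_of_mul_nonneg_right h5 hμ1]

/-! ### Saturating states are boundary points -/

theorem smul_mul_diagonal_mul_add_smul_one {n k : Type*} [Fintype n] [DecidableEq n] [Fintype k]
    [DecidableEq k] {P : Matrix n k ℂ} (hP : P * Pᴴ = 1) (μ : k → ℝ) (a b : ℝ) :
    a • (P * diagonal (fun i => (μ i : ℂ)) * Pᴴ) + b • (1 : Matrix n n ℂ) =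
      P * diagonal (fun i => ((a * μ i + b : ℝ) : ℂ)) * Pᴴ := by
  have h : diagonal (fun i => ((a * μ i + b : ℝ) : ℂ)) =
      a • diagonal (fun i => (μ i : ℂ)) + b • (1 : Matrix k k ℂ) := by
    ext i j
    by_cases hij : i = j
    · subst hij
      simp
    · simp [hij]
  rw [h, Matrix.mul_add, Matrix.add_mul, Matrix.mul_smul, Matrix.smul_mul, Matrix.mul_smul,
    Matrix.smul_mul, Matrix.mul_one, hP]

theorem maxMixed_mem_absSepStates {P : Matrix (Fin 2 × Fin 2) (Fin 4) ℂ}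
    (hP1 : Pᴴ * P = 1) (hP2 : P * Pᴴ = 1) : maxMixed ∈ absSepStates (Fin 2) (Fin 2) := by
  have h := smul_mul_diagonal_mul_add_smul_one hP2 (fun _ => 0) 0 (1 / 4)
  rw [zero_smul, zero_add] at h
  rw [maxMixed, h]
  refine mul_diagonal_mul_mem_absSepStates hP1 hP2 antitone_const (by norm_num) ?_ ?_
  · simp
  · rw [sub_self]
    positivity

/-- The states saturating the spectral criterion lie on the boundary of the absolutely separable
states. -/
theorem mul_diagonal_mul_mem_absSepBoundary {P : Matrix (Fin 2 × Fin 2) (Fin 4) ℂ}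
    (hP1 : Pᴴ * P = 1) (hP2 : P * Pᴴ = 1) {μ : Fin 4 → ℝ} (hμ : Antitone μ) (hμ0 : 0 ≤ μ 3)
    (hμ1 : ∑ i, μ i = 1) (hcond : μ 0 - μ 2 = 2 * √(μ 1 * μ 3)) :
    P * diagonal (fun i => (μ i : ℂ)) * Pᴴ ∈ absSepBoundary (Fin 2) (Fin 2) := by
  set σ := P * diagonal (fun i => (μ i : ℂ)) * Pᴴ with hσ
  have hmem : σ ∈ absSepStates (Fin 2) (Fin 2) :=
    mul_diagonal_mul_mem_absSepStates hP1 hP2 hμ hμ0 hμ1 hcond.le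
  have h10 : μ 1 ≤ μ 0 := hμ (by decide)
  have h21 : μ 2 ≤ μ 1 := hμ (by decide)
  have h32 : μ 3 ≤ μ 2 := hμ (by decide)
  have hpos : 0 < μ 1 := by
    by_contra! hle
    have h1 : μ 1 = 0 := by linarith
    rw [Fin.sum_univ_four] at hμ1
    rw [h1, zero_mul, Real.sqrt_zero, mul_zero] at hcond
    linarith
  have hsq : (μ 0 - μ 2) ^ 2 = 4 * (μ 1 * μ 3) := by
    rw [hcond, mul_pow, Real.sq_sqrt (mul_nonneg hpos.le hμ0)]
    norm_num
  have hσA := subset_affineSpan ℝ _ hmem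
  have hmA := subset_affineSpan ℝ _ (maxMixed_mem_absSepStates hP1 hP2)
  -- The line through `I/4` and `σ`; the parameter `-t` with `t > 0` goes beyond `σ`.
  set γ : ℝ → affineSpan ℝ (absSepStates (Fin 2) (Fin 2)) := fun t =>
    ⟨AffineMap.lineMap σ maxMixed (-t), AffineMap.lineMap_mem (-t) hσA hmA⟩ with hγ
  have hγc : Continuous γ := by
    refine Continuous.subtype_mk ?_ _
    simp only [AffineMap.lineMap_apply, vsub_eq_sub, vadd_eq_add]
    fun_prop
  have hγ0 : γ 0 = ⟨σ, hσA⟩ := by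
    simp [hγ]
  refine (mem_intrinsicFrontier).2 ⟨⟨σ, hσA⟩, ⟨subset_closure hmem, fun hint => ?_⟩, rfl⟩
  rw [mem_interior_iff_mem_nhds, ← hγ0] at hint
  have hev := hγc.continuousAt.eventually hint
  -- Keeps the shifted `μ 1` positive, as the necessity lemma requires.
  have hsmall : ∀ᶠ t : ℝ in nhds 0, t / 4 < μ 1 := by
    refine (Continuous.tendsto (by fun_prop) (0 : ℝ)).eventually_lt_const ?_
    simpa using hpos
  obtain ⟨t, ht, htpos⟩ := ((hev.and hsmall).filter_mono nhdsWithin_le_nhds).and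
    (self_mem_nhdsWithin (s := Set.Ioi (0 : ℝ))) |>.exists
  have htpos' : 0 < t := htpos
  obtain ⟨htm, hts⟩ := ht
  have hline : (AffineMap.lineMap σ maxMixed (-t) : Matrix (Fin 2 × Fin 2) (Fin 2 × Fin 2) ℂ) =
      P * diagonal (fun i => (((1 + t) * μ i + -(t / 4) : ℝ) : ℂ)) * Pᴴ := by
    rw [← smul_mul_diagonal_mul_add_smul_one hP2, ← hσ, AffineMap.lineMap_apply_module, maxMixed,
      smul_smul]
    congr 2 <;> ring
  have hin : P * diagonal (fun i => (((1 + t) * μ i + -(t / 4) : ℝ) : ℂ)) * Pᴴ ∈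
      absSepStates (Fin 2) (Fin 2) := hline ▸ htm
  have hle := sq_le_of_mem_absSepStates hP1 (by nlinarith) hin
  -- After cancelling `hsq`, `hle` would give `(1 + t)(μ 1 + μ 3) ≤ t / 4`, against `t / 4 < μ 1`.
  nlinarith [mul_pos htpos' hpos, mul_nonneg htpos'.le hμ0, mul_nonneg (sq_nonneg t) hμ0]

/-! ### Choice of `ε` and conclusion -/

theorem proposition3
    (ρ : Matrix (Fin 2 × Fin 2) (Fin 2 × Fin 2) ℂ)
    (hstate : IsState ρ)
    (habs : ρ ∈ absSepStates (Fin 2) (Fin 2))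
    (hrank : ρ.rank = 4)
    (hne : ρ ≠ maxMixed)
    (ev : Fin 4 → ℝ)
    (hev : ev = sortedEigenvalues hstate.isHermitian)
    (hlt : ev 0 - ev 2 < 2 * Real.sqrt (ev 1 * ev 3)) :
    ∃ (ε : ℝ) (σ : Matrix (Fin 2 × Fin 2) (Fin 2 × Fin 2) ℂ),
      0 < ε ∧ ε ≤ ev 3 ∧ 4 * ε < 1 ∧
      ev 0 - ev 2 = 2 * Real.sqrt ((ev 1 - ε) * (ev 3 - ε)) ∧
      σ = (1 - 4 * ε)⁻¹ •
        (ρ - ε • (1 : Matrix (Fin 2 × Fin 2) (Fin 2 × Fin 2) ℂ)) ∧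
      σ ∈ absSepStates (Fin 2) (Fin 2) ∧
      σ ∈ absSepBoundary (Fin 2) (Fin 2) ∧
      ρ = (1 - 4 * ε) • σ + (4 * ε) • maxMixed := by
  obtain ⟨P, hP1, hP2, hρ⟩ :=
    hstate.isHermitian.exists_eq_mul_diagonal_eigenvalues₀ (k := 4) (by simp)
  have hρ' : ρ = P * diagonal (fun i => (ev i : ℂ)) * Pᴴ := by
    rw [hev]
    exact hρ
  have hanti : Antitone ev := hev ▸ sortedEigenvalues_antitone _
  have hsum : ∑ i, ev i = 1 := by
    have := hstate.2
    rw [hρ', trace_conj_diagonal hP1] at this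
    exact_mod_cast this
  have hev3 : 0 ≤ ev 3 := by
    have h1 := hstate.1.conjTranspose_mul_mul_same P
    have h2 : Pᴴ * ρ * P = diagonal (fun i => (ev i : ℂ)) := by
      calc Pᴴ * ρ * P = (Pᴴ * P) * diagonal (fun i => (ev i : ℂ)) * (Pᴴ * P) := by
            rw [hρ']
            simp only [Matrix.mul_assoc]
        _ = _ := by rw [hP1, one_mul, mul_one]
    rw [h2, posSemidef_diagonal_iff] at h1
    exact Complex.zero_le_real.1 (h1 3)
  have h10 : ev 1 ≤ ev 0 := hanti (by decide)
  have h21 : ev 2 ≤ ev 1 := hanti (by decide)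
  have h32 : ev 3 ≤ ev 2 := hanti (by decide)
  have hcont : ContinuousOn (fun ε : ℝ => 2 * √((ev 1 - ε) * (ev 3 - ε))) (Set.Icc 0 (ev 3)) := by
    fun_prop
  obtain ⟨ε, ⟨hε0, hε3⟩, hε⟩ := intermediate_value_Icc' hev3 hcont
    (show ev 0 - ev 2 ∈ Set.Icc _ _ by
      constructor
      · simp only [sub_self, mul_zero, Real.sqrt_zero]
        linarith
      · simp only [sub_zero]
        exact hlt.le)
  simp only at hε
  have hεpos : 0 < ε := by
    refine lt_of_le_of_ne hε0 ?_
    rintro rfl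
    rw [sub_zero, sub_zero] at hε
    exact hlt.ne' hε
  have hε4 : 4 * ε < 1 := by
    by_contra! hge
    -- `1/4 ≤ ε ≤ ev 3` bounds all eigenvalues below by `1/4`, while they sum to one.
    have hall : ∀ i, ev i = 1 / 4 := by
      rw [Fin.sum_univ_four] at hsum
      intro i
      fin_cases i <;> simp only [Fin.zero_eta, Fin.mk_one, Fin.reduceFinMk] <;> linarith
    refine hne ?_
    have h := smul_mul_diagonal_mul_add_smul_one hP2 ev 0 (1 / 4)
    rw [zero_smul, zero_add] at h
    rw [maxMixed, h, hρ']
    simp [hall]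
  have hc : 0 < 1 - 4 * ε := by linarith
  set μ : Fin 4 → ℝ := fun i => (1 - 4 * ε)⁻¹ * ev i + -((1 - 4 * ε)⁻¹ * ε) with hμdef
  have hσ : (1 - 4 * ε)⁻¹ • (ρ - ε • (1 : Matrix (Fin 2 × Fin 2) (Fin 2 × Fin 2) ℂ)) =
      P * diagonal (fun i => (μ i : ℂ)) * Pᴴ := by
    rw [hμdef, ← smul_mul_diagonal_mul_add_smul_one hP2, ← hρ', smul_sub, smul_smul, neg_smul,
      sub_eq_add_neg]
  have hμ' : ∀ i, μ i = (1 - 4 * ε)⁻¹ * (ev i - ε) := fun i => by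
    simp only [hμdef]
    ring
  have hci : 0 < (1 - 4 * ε)⁻¹ := inv_pos.2 hc
  have hμanti : Antitone μ := fun i j hij => by
    rw [hμ', hμ']
    exact mul_le_mul_of_nonneg_left (by linarith [hanti hij]) hci.le
  have hμ3 : 0 ≤ μ 3 := by
    rw [hμ']
    exact mul_nonneg hci.le (by linarith)
  have hμsum : ∑ i, μ i = 1 := by
    simp_rw [hμ', ← Finset.mul_sum, Finset.sum_sub_distrib, hsum]
    simp only [Finset.sum_const, Finset.card_univ, Fintype.card_fin, nsmul_eq_mul]
    exact inv_mul_cancel₀ hc.ne'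
  have hμeq : μ 0 - μ 2 = 2 * √(μ 1 * μ 3) := by
    have h1 : μ 1 * μ 3 = (1 - 4 * ε)⁻¹ ^ 2 * ((ev 1 - ε) * (ev 3 - ε)) := by
      rw [hμ', hμ']
      ring
    rw [h1, Real.sqrt_mul (sq_nonneg _), Real.sqrt_sq hci.le, hμ', hμ']
    linear_combination -(1 - 4 * ε)⁻¹ * hε
  refine ⟨ε, _, hεpos, hε3, hε4, hε.symm, rfl, ?_, ?_, ?_⟩
  · rw [hσ]
    exact mul_diagonal_mul_mem_absSepStates hP1 hP2 hμanti hμ3 hμsum hμeq.le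
  · rw [hσ]
    exact mul_diagonal_mul_mem_absSepBoundary hP1 hP2 hμanti hμ3 hμsum hμeq
  · rw [smul_smul, mul_inv_cancel₀ hc.ne', one_smul, maxMixed, smul_smul,
      show 4 * ε * (1 / 4) = ε by ring, sub_add_cancel]

end
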